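/- Let $d\ge 1$ and let $\gamma,C_2,T>0$. There are constants $K,\kappa>0$, depending only on $d,\gamma,C_2,T$, such that the following holds. Let $\beta,L>0$ and let $p_0$ be a probability density on $\mathbb R^d$ such that $$p_0(x)\le \frac{C_2}{(1+\|x\|^2)^{(1+\gamma+d)/2}}\qquad\text{for all }x\in\mathbb R^d,$$ and such that $p_0$ lies in the Sobolev class with parameters $\beta,L$, that is, $\int_{\mathbb R^d}|\omega^\alpha|^2\,|\mathcal F[p_0](\omega)|^2\,d\omega\le(2\pi)^dL^2$ for every multi-index $\alpha\in\mathbb N_0^d$ with $\sum_i\alpha_i=\beta$, where $\mathcal F[p_0](\omega)=\int p_0(x)e^{-i\langle\omega,x\rangle}\,dx$. Let $n\ge 2$, let $t\in(0,T]$, and let $X^{(1)},\dots,X^{(n)}$ be i.i.d. random vectors with density $p_0$. Write $\varphi_t(x)=(2\pi t)^{-d/2}e^{-\|x\|^2/(2t)}$, $p_t=\varphi_t*p_0$, $s_t=\nabla\log p_t$, and $$\hat p_t(x)=\frac1n\sum_{i=1}^n\varphi_t(x-X^{(i)}),\quad \nabla\hat p_t(x)=\frac1{nt}\sum_{i=1}^n(X^{(i)}-x)\varphi_t(x-X^{(i)}),\quad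 \rho_n=\frac{\log n}{n(2\pi t)^{d/2}},\quad \hat s_t=\frac{\nabla\hat p_t}{\hat p_t}\mathbf 1_{\{\hat p_t\ge\rho_n\}}.$$ Then $$\mathbb E\left[\int_{\mathbb R^d}\|\hat s_t(x)-s_t(x)\|^2\,p_t(x)\,dx\right]\le K(\log n)^{\kappa}\,n^{-\frac{\gamma+1}{d+\gamma+1}}\,t^{-1-\frac d2\cdot\frac{\gamma+1}{d+\gamma+1}}.$$ -/

import Mathlib

open MeasureTheory ProbabilityTheory

noncomputable section

namespace ScoreKDE

/-- The Gaussian kernel `φ_t(x) = (2πt)^{-d/2} exp(-‖x‖² / (2t))` on `ℝ^d`. -/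
def gaussKernel {d : ℕ} (t : ℝ) (x : EuclideanSpace ℝ (Fin d)) : ℝ :=
  1 / (2 * Real.pi * t) ^ ((d : ℝ) / 2) * Real.exp (-‖x‖ ^ 2 / (2 * t))

/-- The Fourier transform `F[f](ω) = ∫ f(x) e^{-i⟨ω, x⟩} dx`. -/
def fourierTransform {d : ℕ} (f : EuclideanSpace ℝ (Fin d) → ℝ)
    (ω : EuclideanSpace ℝ (Fin d)) : ℂ :=
  ∫ x, (f x : ℂ) * Complex.exp (-Complex.I * ((inner ℝ ω x : ℝ) : ℂ))

/-- `p` is a probability density on `ℝ^d`. -/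
structure IsDensity {d : ℕ} (p : EuclideanSpace ℝ (Fin d) → ℝ) : Prop where
  integrable : Integrable p
  nonneg : ∀ x, 0 ≤ p x
  integral_eq_one : ∫ x, p x = 1

/-- Polynomial tail decay with tail index `γ` and constant `C₂`. -/
def PolynomialTail {d : ℕ} (γ C₂ : ℝ) (p : EuclideanSpace ℝ (Fin d) → ℝ) : Prop :=
  ∀ x, p x ≤ C₂ / (1 + ‖x‖ ^ 2) ^ ((1 + γ + d) / 2)

/-- The Sobolev class of densities: for every multi-index `α` of order `β`,
`∫ |ω^α|² |F[p](ω)|² dω ≤ (2π)^d L²`. -/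
structure SobolevClass {d : ℕ} (β L : ℝ) (p : EuclideanSpace ℝ (Fin d) → ℝ) : Prop
    extends IsDensity p where
  fourier_bound : ∀ α : Fin d → ℕ, (∑ i, (α i : ℝ)) = β →
    ∫⁻ ω : EuclideanSpace ℝ (Fin d),
        ENNReal.ofReal (|∏ i, ω i ^ α i| ^ 2 * ‖fourierTransform p ω‖ ^ 2)
      ≤ ENNReal.ofReal ((2 * Real.pi) ^ d * L ^ 2)

/-- The probability measure with density `p`. -/
def densityLaw {d : ℕ} (p : EuclideanSpace ℝ (Fin d) → ℝ) :
    Measure (EuclideanSpace ℝ (Fin d)) :=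
  volume.withDensity (fun x => ENNReal.ofReal (p x))

/-- The diffused density `p_t = φ_t * p₀`, the density of `X₀ + √t Z`. -/
def diffused {d : ℕ} (p₀ : EuclideanSpace ℝ (Fin d) → ℝ) (t : ℝ)
    (x : EuclideanSpace ℝ (Fin d)) : ℝ :=
  ∫ y, gaussKernel t (x - y) * p₀ y

/-- The score `s_t = ∇ log p_t`. -/
def score {d : ℕ} (p₀ : EuclideanSpace ℝ (Fin d) → ℝ) (t : ℝ)
    (x : EuclideanSpace ℝ (Fin d)) : EuclideanSpace ℝ (Fin d) :=
  gradient (fun y => Real.log (diffused p₀ t y)) x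

/-- The Gaussian kernel density estimator `p̂_t` built from the sample `X`. -/
def kde {d n : ℕ} (X : Fin n → EuclideanSpace ℝ (Fin d)) (t : ℝ)
    (x : EuclideanSpace ℝ (Fin d)) : ℝ :=
  1 / (n : ℝ) * ∑ i, gaussKernel t (x - X i)

/-- The gradient `∇p̂_t` of the kernel density estimator. -/
def kdeGrad {d n : ℕ} (X : Fin n → EuclideanSpace ℝ (Fin d)) (t : ℝ)
    (x : EuclideanSpace ℝ (Fin d)) : EuclideanSpace ℝ (Fin d) :=
  (1 / ((n : ℝ) * t)) • ∑ i, gaussKernel t (x - X i) • (X i - x)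

/-- The threshold `ρ_n = log n / (n (2πt)^{d/2})`. -/
def threshold (d n : ℕ) (t : ℝ) : ℝ :=
  Real.log n / ((n : ℝ) * (2 * Real.pi * t) ^ ((d : ℝ) / 2))

open Classical in
/-- The thresholded score estimator `ŝ_t = (∇p̂_t / p̂_t) 1{p̂_t ≥ ρ_n}`. -/
def scoreEst {d n : ℕ} (X : Fin n → EuclideanSpace ℝ (Fin d)) (t : ℝ)
    (x : EuclideanSpace ℝ (Fin d)) : EuclideanSpace ℝ (Fin d) :=
  if threshold d n t ≤ kde X t x then (kde X t x)⁻¹ • kdeGrad X t x else 0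

end ScoreKDE

end

/-! The argument reduces the risk to one pointwise bound and then integrates it. Fix `x`, write `Y =
exp(-‖y - x‖²/(2t))`, `q = E Y`, `m = E[Y (y - x)]`; the true score is `m/(tq)`, and the estimator
is the same ratio for the empirical measure, cut off where `S = ∑ Y_i < log n`.

Cauchy–Schwarz followed by Jensen for the concave function `-y log y` gives `‖m/q‖² ≤ 2t log(1/q)`
for every probability measure (`norm_sq_integral_exp_smul_le`). Applied to the empirical measure, it
bounds the thresholded estimator deterministically by a multiple of `(log n)/t` in square.

If `q ≤ 2 log n / n`, these size bounds alone suffice (`error_le_of_small`). If `q` is larger, the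
error is controlled by the squared deviations of numerator and denominator (`error_le_of_large`),
whose expectation is at most `3tnq` (`lintegral_deviation_le`); this cancels the factor `1/q`. A
large-deviation inequality is not needed. Both cases give, up to constants, `(log n / t) · ρ ·
min(1, p_t/ρ)^δ` with `ρ` the threshold and `δ < 1` (`lintegral_error_le`).

Gaussian smoothing keeps the tail of order `‖x‖^{-k}`, `k = 1 + γ + d`, so `p_t` reaches level `ρ`
at radius about `ρ^{-1/k}`. For `kδ > d` the integral over `x` has order `ρ · ρ^{-d/k} =
ρ^{(γ+1)/k}`, which is the rate. -/

namespace ScoreKDE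

/-! ### Size of Gaussian-weighted means. -/

section Jensen

variable {α : Type*} {E : Type*} [NormedAddCommGroup E]

lemma mul_exp_neg_div_le {t : ℝ} (ht : 0 < t) (r : ℝ) :
    r * Real.exp (-r / (2 * t)) ≤ 2 * t := by
  have h1 : r / (2 * t) ≤ Real.exp (r / (2 * t)) := by
    have := Real.add_one_le_exp (r / (2 * t)); linarith
  have h2 : r ≤ 2 * t * Real.exp (r / (2 * t)) := by
    rw [div_le_iff₀ (by positivity)] at h1; linarith
  calc r * Real.exp (-r / (2 * t))
      ≤ (2 * t * Real.exp (r / (2 * t))) * Real.exp (-r / (2 * t)) := by gcongr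
    _ = 2 * t := by rw [mul_assoc, ← Real.exp_add, neg_div]; simp

lemma exp_neg_div_le_one {t : ℝ} (ht : 0 < t) (v : E) : Real.exp (-‖v‖ ^ 2 / (2 * t)) ≤ 1 := by
  rw [Real.exp_le_one_iff, neg_div]
  have : 0 ≤ ‖v‖ ^ 2 / (2 * t) := by positivity
  linarith

lemma norm_exp_smul_le [NormedSpace ℝ E] {t : ℝ} (ht : 0 < t) (v : E) :
    ‖Real.exp (-‖v‖ ^ 2 / (2 * t)) • v‖ ≤ 1 + 2 * t := by
  rw [norm_smul, Real.norm_of_nonneg (Real.exp_pos _).le]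
  have h1 := mul_exp_neg_div_le ht (‖v‖ ^ 2)
  have h2 := exp_neg_div_le_one ht v
  have h3 : ‖v‖ ≤ 1 + ‖v‖ ^ 2 := by nlinarith [sq_nonneg (‖v‖ - 1), norm_nonneg v]
  calc _ ≤ Real.exp (-‖v‖ ^ 2 / (2 * t)) * (1 + ‖v‖ ^ 2) := by gcongr
    _ ≤ 1 + 2 * t := by linarith

/-- Cauchy–Schwarz and Jensen for Gaussian weights. -/
lemma norm_sq_integral_exp_smul_le [InnerProductSpace ℝ E] [CompleteSpace E] [MeasurableSpace α]
    {ν : Measure α} [IsProbabilityMeasure ν] {u : α → E} (hu : AEStronglyMeasurable u ν)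
    {t : ℝ} (ht : 0 < t) :
    ‖∫ a, Real.exp (-‖u a‖ ^ 2 / (2 * t)) • u a ∂ν‖ ^ 2 ≤
      2 * t * (∫ a, Real.exp (-‖u a‖ ^ 2 / (2 * t)) ∂ν) ^ 2 *
        -Real.log (∫ a, Real.exp (-‖u a‖ ^ 2 / (2 * t)) ∂ν) := by
  set Y : α → ℝ := fun a => Real.exp (-‖u a‖ ^ 2 / (2 * t)) with hY
  have hYm : AEStronglyMeasurable Y ν := by
    have : Continuous fun v : E => Real.exp (-‖v‖ ^ 2 / (2 * t)) := by fun_prop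
    exact this.comp_aestronglyMeasurable hu
  have hYi : Integrable Y ν := by
    refine Integrable.of_bound hYm 1 (Filter.Eventually.of_forall fun a => ?_)
    rw [Real.norm_of_nonneg (Real.exp_pos _).le]
    exact exp_neg_div_le_one ht _
  have hZi : Integrable (fun a => Y a • u a) ν :=
    Integrable.of_bound (hYm.smul hu) (1 + 2 * t)
      (Filter.Eventually.of_forall fun a => norm_exp_smul_le ht _)
  have hNi : Integrable (fun a => ‖u a‖ ^ 2 * Y a) ν := by
    refine Integrable.of_bound ((hu.norm.pow 2).mul hYm) (2 * t)
      (Filter.Eventually.of_forall fun a => ?_)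
    have : 0 ≤ ‖u a‖ ^ 2 * Y a := by positivity
    rw [Real.norm_of_nonneg this]
    exact mul_exp_neg_div_le ht _
  set q := ∫ a, Y a ∂ν with hq
  set m := ∫ a, Y a • u a ∂ν with hm
  have hq0 : 0 < q := by
    rw [hq]; exact integral_exp_pos hYi
  -- Cauchy–Schwarz, obtained by integrating `‖u - m/q‖² Y ≥ 0`.
  have key1 : ‖m‖ ^ 2 / q ≤ ∫ a, ‖u a‖ ^ 2 * Y a ∂ν := by
    have h1 : ∫ a, (2 * inner ℝ (q⁻¹ • m) (Y a • u a) - ‖q⁻¹ • m‖ ^ 2 * Y a) ∂ν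
        ≤ ∫ a, ‖u a‖ ^ 2 * Y a ∂ν := by
      refine integral_mono (((hZi.const_inner _).const_mul _).sub (hYi.const_mul _)) hNi
        fun a => ?_
      have h2 : 0 ≤ ‖u a - q⁻¹ • m‖ ^ 2 * Y a := by positivity
      rw [norm_sub_sq_real, real_inner_comm] at h2
      simp only [inner_smul_right (q⁻¹ • m) (u a) (Y a)]
      nlinarith [h2]
    rw [integral_sub ((hZi.const_inner _).const_mul _) (hYi.const_mul _), integral_const_mul,
      integral_const_mul, integral_inner hZi, ← hm, ← hq, real_inner_smul_left,
      real_inner_self_eq_norm_sq, norm_smul, norm_inv, Real.norm_of_nonneg hq0.le] at h1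
    refine le_trans (le_of_eq ?_) h1
    field_simp; ring
  -- Since `‖u‖² = -2t log Y`, this is Jensen for `-y log y`; the integrand is bounded by the
  -- tangent line at `q`.
  have key2 : ∫ a, ‖u a‖ ^ 2 * Y a ∂ν ≤ 2 * t * (q * -Real.log q) := by
    have h1 : ∫ a, ‖u a‖ ^ 2 * Y a ∂ν ≤ ∫ a, 2 * t * (q - (1 + Real.log q) * Y a) ∂ν := by
      refine integral_mono hNi (((integrable_const _).sub (hYi.const_mul _)).const_mul _)
        fun a => ?_
      have hYa : 0 < Y a := Real.exp_pos _
      have h2 : ‖u a‖ ^ 2 = 2 * t * -Real.log (Y a) := by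
        simp only [hY, Real.log_exp]; field_simp
      have h3 := Real.log_le_sub_one_of_pos (div_pos hq0 hYa)
      rw [Real.log_div hq0.ne' hYa.ne'] at h3
      have h4 : Y a * (Real.log q - Real.log (Y a)) ≤ q - Y a := by
        calc _ ≤ Y a * (q / Y a - 1) := by gcongr
          _ = _ := by field_simp
      simp only [h2]
      nlinarith
    rw [integral_const_mul, integral_sub (integrable_const _) (hYi.const_mul _),
      integral_const_mul, ← hq] at h1
    simp at h1
    linarith
  have := key1.trans key2
  rw [div_le_iff₀ hq0] at this
  linarith

/-- The preceding bound under the uniform probability on `Fin n`, where the mean weight is `S/n`. -/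
lemma norm_sq_sum_exp_smul_le [InnerProductSpace ℝ E] [CompleteSpace E] {n : ℕ} (hn : 0 < n)
    (u : Fin n → E) {t : ℝ} (ht : 0 < t) :
    ‖∑ i, Real.exp (-‖u i‖ ^ 2 / (2 * t)) • u i‖ ^ 2 ≤
      2 * t * (∑ i, Real.exp (-‖u i‖ ^ 2 / (2 * t))) ^ 2 *
        Real.log (n / ∑ i, Real.exp (-‖u i‖ ^ 2 / (2 * t))) := by
  have : NeZero n := ⟨hn.ne'⟩
  have hn' : (0 : ℝ) < n := by exact_mod_cast hn
  set ν : Measure (Fin n) := (n : ENNReal)⁻¹ • Measure.count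
  have : IsProbabilityMeasure ν := ⟨by
    simp [ν]
    exact ENNReal.inv_mul_cancel (by simp [hn.ne']) (by simp)⟩
  have h := norm_sq_integral_exp_smul_le (ν := ν) (u := u)
    StronglyMeasurable.of_discrete.aestronglyMeasurable ht
  simp only [ν, integral_smul_measure, integral_count, ENNReal.toReal_inv, ENNReal.toReal_natCast]
    at h
  set S := ∑ i, Real.exp (-‖u i‖ ^ 2 / (2 * t))
  rw [norm_smul, mul_pow, smul_eq_mul, mul_pow, ← Real.log_inv, norm_inv, mul_inv, inv_inv,
    Real.norm_of_nonneg hn'.le, ← div_eq_mul_inv] at h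
  have h2 : (n : ℝ)⁻¹ ^ 2 * (‖∑ i, Real.exp (-‖u i‖ ^ 2 / (2 * t)) • u i‖ ^ 2) ≤
      (n : ℝ)⁻¹ ^ 2 * (2 * t * S ^ 2 * Real.log (n / S)) := by linarith
  exact le_of_mul_le_mul_left h2 (by positivity)

end Jensen

/-! ### Deterministic error bounds at low and at high density. -/

section Pointwise

lemma norm_sub_sq_le_two_mul {E : Type*} [NormedAddCommGroup E] (a b : E) : ‖a - b‖ ^ 2 ≤ 2 * ‖a‖ ^ 2 + 2 * ‖b‖ ^ 2 := by
  have h := norm_sub_le a b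
  have := norm_nonneg (a - b)
  nlinarith [sq_nonneg (‖a‖ - ‖b‖)]

variable {E : Type*} [NormedAddCommGroup E] [InnerProductSpace ℝ E]

/-- The factor 2 covers small `N`, where `log N < 1` and `-log (log N)` is positive. -/
lemma log_div_log_le {N : ℝ} (hN : 2 ≤ N) : Real.log (N / Real.log N) ≤ 2 * Real.log N := by
  have hl : Real.log 2 ≤ Real.log N := Real.log_le_log (by norm_num) hN
  have h2 := Real.log_two_gt_d9
  have hl0 : 0 < Real.log N := by linarith
  have h3 : Real.log (1 / 2) ≤ Real.log (Real.log N) :=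
    Real.log_le_log (by norm_num) (by linarith)
  rw [one_div, Real.log_inv] at h3
  rw [Real.log_div (by linarith) hl0.ne']
  linarith

lemma half_le_log {N : ℝ} (hN : 2 ≤ N) : 1 / 2 ≤ Real.log N := by
  have hl : Real.log 2 ≤ Real.log N := Real.log_le_log (by norm_num) hN
  have h2 := Real.log_two_gt_d9
  linarith

lemma norm_sq_inv_smul_le {t S B : ℝ} {W : E} (hS : 0 < S) (hW : ‖W‖ ^ 2 ≤ 2 * t * S ^ 2 * B) :
    ‖S⁻¹ • W‖ ^ 2 ≤ 2 * t * B := by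
  rw [norm_smul, norm_inv, Real.norm_of_nonneg hS.le, mul_pow, inv_pow]
  rw [inv_mul_le_iff₀ (by positivity)]
  linarith

/-- The threshold forces `N/S ≤ N / log N`, so the logarithm in the Jensen bound is at most `2 log
N` for every sample. -/
lemma norm_sq_thresholded_le {t N S : ℝ} {W : E} (ht : 0 < t) (hN : 2 ≤ N)
    (hW : ‖W‖ ^ 2 ≤ 2 * t * S ^ 2 * Real.log (N / S)) :
    ‖if Real.log N ≤ S then S⁻¹ • W else 0‖ ^ 2 ≤ 4 * t * Real.log N := by
  have hl := half_le_log hN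
  split_ifs with h
  · have hS : 0 < S := by linarith
    refine (norm_sq_inv_smul_le hS hW).trans ?_
    have : Real.log (N / S) ≤ Real.log (N / Real.log N) := by
      apply Real.log_le_log (by positivity)
      gcongr
    have := this.trans (log_div_log_le hN)
    nlinarith
  · have : 0 < 4 * t * Real.log N := by positivity
    simpa using this.le

lemma self_le_two_mul_min_one_rpow {r δ : ℝ} (hr : 0 < r) (hr2 : r ≤ 2) (hδ : 0 < δ)
    (hδ1 : δ ≤ 1) : r ≤ 2 * min 1 r ^ δ ∧ r ^ δ ≤ 2 * min 1 r ^ δ := by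
  have h1 : r ≤ 2 * min 1 r := by
    rcases min_cases 1 r with h | h <;> rw [h.1] <;> linarith
  have hm0 : 0 < min 1 r := lt_min one_pos hr
  have h2 : min 1 r ≤ min 1 r ^ δ := by
    simpa using Real.rpow_le_rpow_of_exponent_ge hm0 (min_le_left _ _) hδ1
  refine ⟨by linarith, ?_⟩
  calc r ^ δ ≤ (2 * min 1 r) ^ δ := Real.rpow_le_rpow hr.le h1 hδ.le
    _ = 2 ^ δ * min 1 r ^ δ := Real.mul_rpow (by norm_num) hm0.le
    _ ≤ 2 * min 1 r ^ δ := by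
      gcongr
      simpa using Real.rpow_le_rpow_of_exponent_le (x := 2) (by norm_num) hδ1

/-- Error at points where the density is below twice the threshold. -/
lemma error_le_of_small {t N S q δ : ℝ} {W m : E} (ht : 0 < t) (hN : 2 ≤ N)
    (hW : ‖W‖ ^ 2 ≤ 2 * t * S ^ 2 * Real.log (N / S)) (hq : 0 < q)
    (hm : ‖m‖ ^ 2 ≤ 2 * t * q ^ 2 * -Real.log q) (hδ : 0 < δ) (hδ1 : δ < 1)
    (hsmall : q ≤ 2 * (Real.log N / N)) :
    q * ‖(if Real.log N ≤ S then S⁻¹ • W else 0) - q⁻¹ • m‖ ^ 2 ≤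
      (32 + 16 / (1 - δ)) * t * Real.log N *
        (Real.log N / N * min 1 (q / (Real.log N / N)) ^ δ) := by
  set l := Real.log N with hldef
  have hl : 1 / 2 ≤ l := half_le_log hN
  set lam := l / N with hlam
  have hlam0 : 0 < lam := by positivity
  set r := q / lam with hr
  have hr0 : 0 < r := by positivity
  have hr2 : r ≤ 2 := by rw [hr, div_le_iff₀ hlam0]; linarith
  obtain ⟨hm1, hm2⟩ := self_le_two_mul_min_one_rpow hr0 hr2 hδ hδ1.le
  set M := min 1 r ^ δ
  have hε : 0 < 1 - δ := by linarith
  have e1 := norm_sub_sq_le_two_mul (if l ≤ S then S⁻¹ • W else 0) (q⁻¹ • m)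
  have e2 := norm_sq_thresholded_le ht hN hW
  rw [← hldef] at e2
  have e3 := norm_sq_inv_smul_le hq hm
  have hlog : -Real.log q = Real.log (1 / lam) + Real.log (1 / r) := by
    rw [hr, ← Real.log_mul (by positivity) (by positivity), ← Real.log_inv]
    congr 1; field_simp
  have hlog1 : Real.log (1 / lam) ≤ 2 * l := by
    have := log_div_log_le hN
    rwa [← hldef, ← one_div_div] at this
  -- The unbounded part of `log(1/q)` is traded for a power: `r (1/r)^(1-δ) = r^δ`. This is why `δ <
  -- 1` is required and where `1/(1-δ)` arises.
  have hlog2 : Real.log (1 / r) ≤ (1 / r) ^ (1 - δ) / (1 - δ) :=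
    Real.log_le_rpow_div (by positivity) hε
  have hrr : r * (1 / r) ^ (1 - δ) = r ^ δ := by
    rw [one_div, Real.inv_rpow hr0.le, ← Real.rpow_neg hr0.le]
    nth_rewrite 1 [← Real.rpow_one r]
    rw [← Real.rpow_add hr0]; congr 1; ring
  have hq_eq : q = lam * r := by rw [hr]; field_simp
  calc q * ‖(if l ≤ S then S⁻¹ • W else 0) - q⁻¹ • m‖ ^ 2
      ≤ q * (2 * (4 * t * l) + 2 * (2 * t * (2 * l + (1 / r) ^ (1 - δ) / (1 - δ)))) := by
        gcongr
        refine e1.trans ?_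
        gcongr
        refine e3.trans ?_
        gcongr
        linarith
    _ = 16 * t * l * lam * r + 4 * t * lam / (1 - δ) * (r * (1 / r) ^ (1 - δ)) := by
        rw [hq_eq]; field_simp; ring
    _ ≤ 16 * t * l * lam * (2 * M) + 4 * t * lam / (1 - δ) * (2 * M) := by
        rw [hrr]; gcongr
    _ = 32 * t * l * lam * M + 8 * t * lam / (1 - δ) * M * 1 := by ring
    _ ≤ 32 * t * l * lam * M + 8 * t * lam / (1 - δ) * M * (2 * l) := by
        gcongr; linarith
    _ = (32 + 16 / (1 - δ)) * t * l * (lam * M) := by ring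

/-- Error at points where the density exceeds twice the threshold, in terms of the deviations of
the numerator and the denominator. -/
lemma error_le_of_large {t N S q : ℝ} {W m : E} (ht : 0 < t) (hN : 2 ≤ N)
    (hW : ‖W‖ ^ 2 ≤ 2 * t * S ^ 2 * Real.log (N / S))
    (hm : ‖m‖ ^ 2 ≤ 2 * t * q ^ 2 * -Real.log q)
    (hlarge : 2 * (Real.log N / N) ≤ q) :
    q * ‖(if Real.log N ≤ S then S⁻¹ • W else 0) - q⁻¹ • m‖ ^ 2 ≤
      64 * Real.log N / (N ^ 2 * q) * (‖W - N • m‖ ^ 2 + t * (S - N * q) ^ 2) := by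
  set l := Real.log N with hldef
  have hl : 1 / 2 ≤ l := half_le_log hN
  have hN0 : 0 < N := by linarith
  have hlam0 : 0 < l / N := by positivity
  have hq : 0 < q := by linarith
  have e1 := norm_sub_sq_le_two_mul (if l ≤ S then S⁻¹ • W else 0) (q⁻¹ • m)
  have e2 := norm_sq_thresholded_le ht hN hW
  rw [← hldef] at e2
  have e3 : ‖q⁻¹ • m‖ ^ 2 ≤ 4 * t * l := by
    have h1 := norm_sq_inv_smul_le hq hm
    have hlog1 : -Real.log q ≤ 2 * l := by
      rw [← Real.log_inv]
      refine le_trans (Real.log_le_log (by positivity) ?_) (log_div_log_le hN)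
      rw [← hldef, ← inv_div]
      apply inv_anti₀ hlam0; linarith
    nlinarith
  have hNq : l ≤ N * q / 2 := by
    have : 2 * (l / N) * N ≤ q * N := by gcongr
    have h2 : 2 * (l / N) * N = 2 * l := by field_simp
    linarith
  have hNq0 : 0 < N * q := by positivity
  set V := ‖W - N • m‖ ^ 2 + t * (S - N * q) ^ 2 with hV
  have hV0 : 0 ≤ V := by positivity
  suffices h : ‖(if l ≤ S then S⁻¹ • W else 0) - q⁻¹ • m‖ ^ 2 ≤ 64 * l / (N * q) ^ 2 * V by
    calc _ ≤ q * (64 * l / (N * q) ^ 2 * V) := by gcongr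
      _ = _ := by field_simp
  -- If `S ≥ Nq/2`, the threshold is passed and the error of the quotient is linear in the two
  -- deviations. Otherwise `|S - Nq| ≥ Nq/2`, so the deviation term alone dominates the
  -- deterministic bound `16 t l`.
  by_cases hS : N * q / 2 ≤ S
  · have hS0 : 0 < S := by linarith
    rw [if_pos (hNq.trans hS)]
    have hid : S⁻¹ • W - q⁻¹ • m = S⁻¹ • ((W - N • m) - (S - N * q) • (q⁻¹ • m)) := by
      have h1 : W = (W - N • m) + N • m := by abel
      rw [smul_sub, smul_smul, smul_smul, ← sub_add_cancel W (N • m), smul_add, add_sub_cancel_right,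
        add_sub_assoc, sub_eq_add_neg (S⁻¹ • (W - N • m)), smul_smul, ← sub_smul, ← neg_smul]
      congr 2; field_simp; ring
    have h5 := norm_sub_sq_le_two_mul (W - N • m) ((S - N * q) • (q⁻¹ • m))
    rw [norm_smul (S - N * q), mul_pow, Real.norm_eq_abs, sq_abs] at h5
    rw [hid, norm_smul, norm_inv, Real.norm_of_nonneg hS0.le, mul_pow]
    have h6 : ‖(W - N • m) - (S - N * q) • (q⁻¹ • m)‖ ^ 2 ≤ 8 * l * V := by
      have h7 : (S - N * q) ^ 2 * ‖q⁻¹ • m‖ ^ 2 ≤ (S - N * q) ^ 2 * (4 * t * l) := by gcongr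
      have h8 : ‖W - N • m‖ ^ 2 * 1 ≤ ‖W - N • m‖ ^ 2 * (4 * l) := by gcongr; linarith
      rw [hV]; linarith
    have h9 : S⁻¹ ≤ 2 / (N * q) := by
      rw [← inv_div]; exact inv_anti₀ (by positivity) hS
    calc S⁻¹ ^ 2 * ‖(W - N • m) - (S - N * q) • (q⁻¹ • m)‖ ^ 2
        ≤ (2 / (N * q)) ^ 2 * (8 * l * V) := by gcongr
      _ = 32 * l / (N * q) ^ 2 * V := by ring
      _ ≤ 64 * l / (N * q) ^ 2 * V := by gcongr; norm_num
  · push Not at hS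
    have h1 : (N * q) ^ 2 / 4 ≤ (S - N * q) ^ 2 := by nlinarith
    have h2 : t * ((N * q) ^ 2 / 4) ≤ V := by
      have : t * ((N * q) ^ 2 / 4) ≤ t * (S - N * q) ^ 2 := by gcongr
      rw [hV]; nlinarith [sq_nonneg ‖W - N • m‖]
    calc _ ≤ 16 * t * l := by linarith
      _ = 64 * l / (N * q) ^ 2 * (t * ((N * q) ^ 2 / 4)) := by field_simp; norm_num
      _ ≤ _ := by gcongr

end Pointwise

/-! ### Score and estimator as ratios of Gaussian-weighted means. -/

section

variable {d : ℕ}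

/-- The unnormalised Gaussian weight `exp (-‖y - x‖² / (2t))`. -/
noncomputable def gaussWeight (t : ℝ) (x y : EuclideanSpace ℝ (Fin d)) : ℝ :=
  Real.exp (-‖y - x‖ ^ 2 / (2 * t))

lemma gaussWeight_pos (t : ℝ) (x y : EuclideanSpace ℝ (Fin d)) : 0 < gaussWeight t x y :=
  Real.exp_pos _

lemma gaussWeight_le_one {t : ℝ} (ht : 0 < t) (x y : EuclideanSpace ℝ (Fin d)) :
    gaussWeight t x y ≤ 1 := exp_neg_div_le_one ht _

lemma continuous_gaussWeight_right (t : ℝ) (x : EuclideanSpace ℝ (Fin d)) :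
    Continuous (gaussWeight t x) := by
  unfold gaussWeight; fun_prop

lemma gaussKernel_sub (t : ℝ) (x y : EuclideanSpace ℝ (Fin d)) :
    gaussKernel t (x - y) = 1 / (2 * Real.pi * t) ^ ((d : ℝ) / 2) * gaussWeight t x y := by
  rw [gaussKernel, gaussWeight, norm_sub_rev]

section Law

variable {p : EuclideanSpace ℝ (Fin d) → ℝ}

lemma IsDensity.isProbabilityMeasure (hp : IsDensity p) :
    IsProbabilityMeasure (densityLaw p) := by
  constructor
  rw [densityLaw, withDensity_apply _ MeasurableSet.univ, Measure.restrict_univ,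
    ← ofReal_integral_eq_lintegral_ofReal hp.integrable
      (Filter.Eventually.of_forall hp.nonneg), hp.integral_eq_one, ENNReal.ofReal_one]

lemma IsDensity.integral_densityLaw (hp : IsDensity p) (f : EuclideanSpace ℝ (Fin d) → ℝ) :
    ∫ y, f y ∂(densityLaw p) = ∫ y, f y * p y := by
  rw [densityLaw, integral_withDensity_eq_integral_toReal_smul₀
    hp.integrable.aestronglyMeasurable.aemeasurable.ennreal_ofReal
    (Filter.Eventually.of_forall fun _ => ENNReal.ofReal_lt_top)]
  refine integral_congr_ae (Filter.Eventually.of_forall fun y => ?_)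
  simp [ENNReal.toReal_ofReal (hp.nonneg y), mul_comm]

lemma IsDensity.diffused_eq (hp : IsDensity p) (t : ℝ) (x : EuclideanSpace ℝ (Fin d)) :
    diffused p t x = 1 / (2 * Real.pi * t) ^ ((d : ℝ) / 2) *
      ∫ y, gaussWeight t x y ∂(densityLaw p) := by
  rw [hp.integral_densityLaw, diffused, ← integral_const_mul]
  refine integral_congr_ae (Filter.Eventually.of_forall fun y => ?_)
  simp only [gaussKernel_sub]; ring

end Law

section Gradient

variable {t : ℝ} (μ : Measure (EuclideanSpace ℝ (Fin d))) [IsProbabilityMeasure μ]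

lemma integrable_gaussWeight (ht : 0 < t) (x : EuclideanSpace ℝ (Fin d)) :
    Integrable (gaussWeight t x) μ := by
  refine Integrable.of_bound ?_ 1 (Filter.Eventually.of_forall fun y => ?_)
  · exact (continuous_gaussWeight_right t x).aestronglyMeasurable
  · rw [Real.norm_of_nonneg (gaussWeight_pos _ _ _).le]; exact gaussWeight_le_one ht _ _

lemma integrable_gaussWeight_smul (ht : 0 < t) (x : EuclideanSpace ℝ (Fin d)) :
    Integrable (fun y => gaussWeight t x y • (y - x)) μ := by
  refine Integrable.of_bound ?_ (1 + 2 * t) (Filter.Eventually.of_forall fun y => ?_)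
  · refine Continuous.aestronglyMeasurable ?_
    exact (continuous_gaussWeight_right t x).smul (by fun_prop)
  · exact norm_exp_smul_le ht _

lemma integral_gaussWeight_pos (ht : 0 < t) (x : EuclideanSpace ℝ (Fin d)) :
    0 < ∫ y, gaussWeight t x y ∂μ := integral_exp_pos (integrable_gaussWeight μ ht x)

lemma hasFDerivAt_gaussWeight (t : ℝ) (x y : EuclideanSpace ℝ (Fin d)) :
    HasFDerivAt (fun x => gaussWeight t x y)
      (innerSL ℝ (t⁻¹ • gaussWeight t x y • (y - x))) x := by
  have h1 : HasFDerivAt (fun x : EuclideanSpace ℝ (Fin d) => y - x)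
      (-ContinuousLinearMap.id ℝ _) x := (hasFDerivAt_id x).const_sub y
  have h2 := h1.norm_sq
  have h3 := ((h2.neg).mul_const (2 * t)⁻¹).exp
  refine (h3.congr_fderiv ?_)
  ext v
  simp [gaussWeight, div_eq_mul_inv]
  ring

/-- Differentiation under the integral; `norm_exp_smul_le` bounds the derivative uniformly in both
points, so a constant dominates. -/
lemma hasFDerivAt_integral_gaussWeight (ht : 0 < t) (x : EuclideanSpace ℝ (Fin d)) :
    HasFDerivAt (fun x => ∫ y, gaussWeight t x y ∂μ)
      (innerSL ℝ (t⁻¹ • ∫ y, gaussWeight t x y • (y - x) ∂μ)) x := by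
  have hint : Integrable (fun y => t⁻¹ • gaussWeight t x y • (y - x)) μ :=
    (integrable_gaussWeight_smul μ ht x).smul t⁻¹
  have hmeas : AEStronglyMeasurable
      (fun y => innerSL ℝ (t⁻¹ • gaussWeight t x y • (y - x))) μ :=
    (innerSL ℝ).continuous.comp_aestronglyMeasurable hint.aestronglyMeasurable
  have hbound : ∀ z y : EuclideanSpace ℝ (Fin d),
      ‖innerSL ℝ (t⁻¹ • gaussWeight t z y • (y - z))‖ ≤ t⁻¹ * (1 + 2 * t) := fun z y => by
    rw [innerSL_apply_norm, norm_smul, Real.norm_of_nonneg (by positivity)]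
    gcongr
    exact norm_exp_smul_le ht _
  have key := hasFDerivAt_integral_of_dominated_of_fderiv_le (𝕜 := ℝ) (μ := μ)
    (F := fun x y => gaussWeight t x y)
    (F' := fun x y => innerSL ℝ (t⁻¹ • gaussWeight t x y • (y - x)))
    (bound := fun _ => t⁻¹ * (1 + 2 * t)) (s := Set.univ) (x₀ := x) Filter.univ_mem
    (Filter.Eventually.of_forall fun z => (integrable_gaussWeight μ ht z).aestronglyMeasurable)
    (integrable_gaussWeight μ ht x) hmeas
    (Filter.Eventually.of_forall fun y z _ => hbound z y) (integrable_const _)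
    (Filter.Eventually.of_forall fun y z _ => hasFDerivAt_gaussWeight t z y)
  refine key.congr_fderiv ?_
  have hint' : Integrable (fun y => innerSL ℝ (t⁻¹ • gaussWeight t x y • (y - x))) μ :=
    Integrable.of_bound hmeas _ (Filter.Eventually.of_forall fun y => hbound x y)
  ext v
  rw [ContinuousLinearMap.integral_apply hint']
  simp only [innerSL_apply_apply]
  rw [← integral_smul, real_inner_comm, ← integral_inner hint v]
  refine integral_congr_ae (Filter.Eventually.of_forall fun y => ?_)
  simp [real_inner_comm]

lemma continuous_integral_gaussWeight (ht : 0 < t) :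
    Continuous fun x => ∫ y, gaussWeight t x y ∂μ :=
  continuous_iff_continuousAt.2 fun x => (hasFDerivAt_integral_gaussWeight μ ht x).continuousAt

end Gradient

lemma IsDensity.score_eq {p : EuclideanSpace ℝ (Fin d) → ℝ} (hp : IsDensity p) {t : ℝ}
    (ht : 0 < t) (x : EuclideanSpace ℝ (Fin d)) :
    score p t x = t⁻¹ • (∫ y, gaussWeight t x y ∂(densityLaw p))⁻¹ •
      ∫ y, gaussWeight t x y • (y - x) ∂(densityLaw p) := by
  have := hp.isProbabilityMeasure
  have hq := integral_gaussWeight_pos (densityLaw p) ht x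
  have hc : 0 < 1 / (2 * Real.pi * t) ^ ((d : ℝ) / 2) := by positivity
  have h1 := (((hasFDerivAt_integral_gaussWeight (densityLaw p) ht x).const_mul
    (1 / (2 * Real.pi * t) ^ ((d : ℝ) / 2))).log (by positivity))
  apply HasGradientAt.gradient
  rw [hasGradientAt_iff_hasFDerivAt]
  have h2 : (fun y => Real.log (diffused p t y)) = fun x =>
      Real.log (1 / (2 * Real.pi * t) ^ ((d : ℝ) / 2) *
        ∫ y, gaussWeight t x y ∂(densityLaw p)) := by
    ext y; rw [hp.diffused_eq]
  rw [h2]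
  refine h1.congr_fderiv ?_
  ext v
  simp
  field_simp

lemma kde_eq {n : ℕ} (X : Fin n → EuclideanSpace ℝ (Fin d)) (t : ℝ)
    (x : EuclideanSpace ℝ (Fin d)) :
    kde X t x = 1 / (2 * Real.pi * t) ^ ((d : ℝ) / 2) / n * ∑ i, gaussWeight t x (X i) := by
  simp only [kde, gaussKernel_sub, ← Finset.mul_sum]; ring

lemma kdeGrad_eq {n : ℕ} (X : Fin n → EuclideanSpace ℝ (Fin d)) (t : ℝ)
    (x : EuclideanSpace ℝ (Fin d)) :
    kdeGrad X t x = (1 / (2 * Real.pi * t) ^ ((d : ℝ) / 2) / n * t⁻¹) •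
      ∑ i, gaussWeight t x (X i) • (X i - x) := by
  simp only [kdeGrad, gaussKernel_sub, mul_smul, ← Finset.smul_sum]
  simp only [smul_smul]; congr 1; field_simp

/-- The Gaussian normalisation and `1/n` cancel in the ratio and in the threshold, which becomes `S
≥ log n`. -/
lemma scoreEst_eq {n : ℕ} (hn : 0 < n) (X : Fin n → EuclideanSpace ℝ (Fin d)) {t : ℝ}
    (ht : 0 < t) (x : EuclideanSpace ℝ (Fin d)) :
    scoreEst X t x = t⁻¹ • if Real.log n ≤ ∑ i, gaussWeight t x (X i) then
      (∑ i, gaussWeight t x (X i))⁻¹ • ∑ i, gaussWeight t x (X i) • (X i - x) else 0 := by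
  have hn' : (0 : ℝ) < n := by exact_mod_cast hn
  have hc : 0 < 1 / (2 * Real.pi * t) ^ ((d : ℝ) / 2) / n := by positivity
  have hiff : threshold d n t ≤ kde X t x ↔ Real.log n ≤ ∑ i, gaussWeight t x (X i) := by
    have : threshold d n t = 1 / (2 * Real.pi * t) ^ ((d : ℝ) / 2) / n * Real.log n := by
      rw [threshold]; field_simp
    rw [this, kde_eq, mul_le_mul_iff_right₀ hc]
  have hiff' := hiff
  unfold scoreEst
  simp only [hiff']
  split_ifs
  · rw [kde_eq, kdeGrad_eq, smul_smul, smul_smul]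
    congr 1; field_simp
  · simp

end

/-! ### Variance of the empirical sums. -/

section Variance

variable {Ω E : Type*} [MeasurableSpace Ω] [MeasurableSpace E] {P : Measure Ω}
  [IsProbabilityMeasure P] {μ : Measure E} {n : ℕ} {X : Fin n → Ω → E}

lemma integral_sq_sum_sub_le (hX : ∀ i, HasLaw (X i) μ P) (hind : iIndepFun X P) {f : E → ℝ}
    (hf : Measurable f) {B : ℝ} (hB : ∀ y, |f y| ≤ B) :
    Integrable (fun ω => (∑ i, f (X i ω) - n * ∫ y, f y ∂μ) ^ 2) P ∧
      ∫ ω, (∑ i, f (X i ω) - n * ∫ y, f y ∂μ) ^ 2 ∂P ≤ n * ∫ y, f y ^ 2 ∂μ := by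
  have hmeas : ∀ i, AEStronglyMeasurable (f ∘ X i) P := fun i =>
    (hf.comp_aemeasurable (hX i).aemeasurable).aestronglyMeasurable
  have hLp : ∀ i, MemLp (f ∘ X i) 2 P := fun i =>
    MemLp.of_bound (hmeas i) B (Filter.Eventually.of_forall fun ω => hB _)
  have hLpS : MemLp (∑ i, f ∘ X i) 2 P := memLp_finsetSum' _ fun i _ => hLp i
  have hmean : ∫ ω, (∑ i, f ∘ X i) ω ∂P = n * ∫ y, f y ∂μ := by
    simp only [Finset.sum_apply]
    rw [integral_finsetSum _ fun i _ => (hLp i).integrable (by norm_num)]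
    simp [fun i => (hX i).integral_comp hf.aestronglyMeasurable, -Function.comp_apply]
  have hsum : ∀ ω, (∑ i, f ∘ X i) ω = ∑ i, f (X i ω) := fun ω => by simp
  have hcomp := hind.comp (fun _ => f) (fun _ => hf)
  have hvar : Var[∑ i, f ∘ X i; P] = ∑ i, Var[f ∘ X i; P] :=
    IndepFun.variance_sum (fun i _ => hLp i) fun i _ j _ hij => hcomp.indepFun hij
  have hvi : ∀ i, Var[f ∘ X i; P] ≤ ∫ y, f y ^ 2 ∂μ := fun i => by
    refine (variance_le_expectation_sq (hmeas i)).trans (le_of_eq ?_)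
    exact (hX i).integral_comp (f := fun y => f y ^ 2) (hf.pow_const 2).aestronglyMeasurable
  constructor
  · have h := (hLpS.sub (memLp_const (n * ∫ y, f y ∂μ))).integrable_sq
    simpa using h
  · have h := variance_eq_integral hLpS.aestronglyMeasurable.aemeasurable
    rw [hmean] at h
    simp only [hsum] at h
    rw [← h, hvar]
    calc _ ≤ ∑ _i : Fin n, ∫ y, f y ^ 2 ∂μ := Finset.sum_le_sum fun i _ => hvi i
      _ = _ := by simp

end Variance

/-- The numerator is treated coordinatewise: the second moments add up to `E[‖y - x‖² Y²] ≤ 2t E Y`.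
The denominator uses `Y² ≤ Y` and adds `t E Y`. Linearity in `E Y` is what later cancels `1/q`. -/
lemma lintegral_deviation_le {d : ℕ} {Ω : Type*} [MeasurableSpace Ω] {P : Measure Ω}
    [IsProbabilityMeasure P] {μ : Measure (EuclideanSpace ℝ (Fin d))} [IsProbabilityMeasure μ]
    {n : ℕ} {X : Fin n → Ω → EuclideanSpace ℝ (Fin d)}
    (hX : ∀ i, HasLaw (X i) μ P) (hind : iIndepFun X P) {t : ℝ} (ht : 0 < t)
    (x : EuclideanSpace ℝ (Fin d)) :
    ∫⁻ ω, ENNReal.ofReal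
      (‖∑ i, gaussWeight t x (X i ω) • (X i ω - x) -
          (n : ℝ) • ∫ y, gaussWeight t x y • (y - x) ∂μ‖ ^ 2 +
        t * (∑ i, gaussWeight t x (X i ω) - n * ∫ y, gaussWeight t x y ∂μ) ^ 2) ∂P
      ≤ ENNReal.ofReal (3 * t * n * ∫ y, gaussWeight t x y ∂μ) := by
  have hcont : Continuous (gaussWeight t x) := continuous_gaussWeight_right t x
  have hb : ∀ y, |gaussWeight t x y| ≤ 1 := fun y => by
    rw [abs_of_pos (gaussWeight_pos _ _ _)]; exact gaussWeight_le_one ht _ _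
  have hS := integral_sq_sum_sub_le hX hind hcont.measurable hb
  have hcontj : ∀ j, Continuous fun y => gaussWeight t x y * (y j - x j) := fun j =>
    hcont.mul (by fun_prop)
  have hbj : ∀ j y, |gaussWeight t x y * (y j - x j)| ≤ 1 + 2 * t := fun j y => by
    have h1 := PiLp.norm_apply_le (gaussWeight t x y • (y - x)) j
    simp only [PiLp.smul_apply, PiLp.sub_apply, smul_eq_mul, Real.norm_eq_abs] at h1
    exact h1.trans (norm_exp_smul_le ht _)
  have hW := fun j => integral_sq_sum_sub_le hX hind (hcontj j).measurable (hbj j)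
  have hsq_int : ∀ j, Integrable (fun y => (gaussWeight t x y * (y j - x j)) ^ 2) μ := fun j =>
    Integrable.of_bound ((hcontj j).pow 2).aestronglyMeasurable ((1 + 2 * t) ^ 2)
      (Filter.Eventually.of_forall fun y => by
        rw [norm_pow, Real.norm_eq_abs]; gcongr; exact hbj j y)
  have hYi := integrable_gaussWeight μ ht x
  have hYsq : Integrable (fun y => gaussWeight t x y ^ 2) μ :=
    Integrable.of_bound (hcont.pow 2).aestronglyMeasurable 1
      (Filter.Eventually.of_forall fun y => by
        rw [norm_pow, Real.norm_of_nonneg (gaussWeight_pos _ _ _).le]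
        exact pow_le_one₀ (gaussWeight_pos _ _ _).le (gaussWeight_le_one ht _ _))
  have hnorm : ∀ ω, ‖∑ i, gaussWeight t x (X i ω) • (X i ω - x) -
      (n : ℝ) • ∫ y, gaussWeight t x y • (y - x) ∂μ‖ ^ 2 =
      ∑ j, (∑ i, gaussWeight t x (X i ω) * (X i ω j - x j) -
        n * ∫ y, gaussWeight t x y * (y j - x j) ∂μ) ^ 2 := fun ω => by
    rw [EuclideanSpace.real_norm_sq_eq]
    refine Finset.sum_congr rfl fun j _ => ?_
    have h1 : (∫ y, gaussWeight t x y • (y - x) ∂μ) j =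
        ∫ y, gaussWeight t x y * (y j - x j) ∂μ :=
      ((EuclideanSpace.proj (𝕜 := ℝ) j).integral_comp_comm
        (integrable_gaussWeight_smul μ ht x)).symm
    simp [h1]
  simp only [hnorm]
  have hsumint : Integrable (fun ω => ∑ j, (∑ i, gaussWeight t x (X i ω) * (X i ω j - x j) -
        n * ∫ y, gaussWeight t x y * (y j - x j) ∂μ) ^ 2) P :=
    integrable_finsetSum _ fun j _ => (hW j).1
  have hadd : Integrable (fun ω => ∑ j, (∑ i, gaussWeight t x (X i ω) * (X i ω j - x j) -
        n * ∫ y, gaussWeight t x y * (y j - x j) ∂μ) ^ 2 +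
      t * (∑ i, gaussWeight t x (X i ω) - n * ∫ y, gaussWeight t x y ∂μ) ^ 2) P :=
    hsumint.add (hS.1.const_mul t)
  rw [← ofReal_integral_eq_lintegral_ofReal hadd
    (Filter.Eventually.of_forall fun ω => by positivity)]
  apply ENNReal.ofReal_le_ofReal
  rw [integral_add hsumint (hS.1.const_mul t), integral_const_mul,
    integral_finsetSum _ fun j _ => (hW j).1]
  have h1 : ∑ j, ∫ ω, (∑ i, gaussWeight t x (X i ω) * (X i ω j - x j) -
      n * ∫ y, gaussWeight t x y * (y j - x j) ∂μ) ^ 2 ∂P ≤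
      n * (2 * t * ∫ y, gaussWeight t x y ∂μ) := by
    calc _ ≤ ∑ j, n * ∫ y, (gaussWeight t x y * (y j - x j)) ^ 2 ∂μ :=
          Finset.sum_le_sum fun j _ => (hW j).2
      _ = n * ∫ y, ∑ j, (gaussWeight t x y * (y j - x j)) ^ 2 ∂μ := by
          rw [← Finset.mul_sum, integral_finsetSum _ fun j _ => hsq_int j]
      _ ≤ n * ∫ y, 2 * t * gaussWeight t x y ∂μ := by
          gcongr
          · exact integrable_finsetSum _ fun j _ => hsq_int j
          · exact hYi.const_mul _
          · intro y
            have h2 := EuclideanSpace.real_norm_sq_eq (y - x)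
            have h3 := mul_exp_neg_div_le ht (‖y - x‖ ^ 2)
            have h4 : ∑ j, (gaussWeight t x y * (y j - x j)) ^ 2 =
                (‖y - x‖ ^ 2 * gaussWeight t x y) * gaussWeight t x y := by
              rw [h2]; simp only [mul_pow, ← Finset.mul_sum, PiLp.sub_apply]; ring
            simp only [h4]
            exact mul_le_mul_of_nonneg_right h3 (gaussWeight_pos _ _ _).le
      _ = _ := by rw [integral_const_mul]
  have h2 : ∫ y, gaussWeight t x y ^ 2 ∂μ ≤ ∫ y, gaussWeight t x y ∂μ := by
    refine integral_mono hYsq hYi fun y => ?_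
    have := gaussWeight_le_one ht x y
    have := gaussWeight_pos t x y
    simp only; nlinarith
  have h3 : t * ∫ ω, (∑ i, gaussWeight t x (X i ω) - n * ∫ y, gaussWeight t x y ∂μ) ^ 2 ∂P ≤
      t * (n * ∫ y, gaussWeight t x y ∂μ) := by
    gcongr
    exact hS.2.trans (by gcongr)
  linarith

/-! ### Tail of the diffused density and the integral over space. -/

section

variable {d : ℕ}

/-- Obtained from `z ≤ exp z` at `z = (1+u)/(4Tm)`. The rate `1/(4T)` uses at most half of the
Gaussian exponent `1/(2t)` when `t ≤ T`. -/
lemma one_add_rpow_le_exp {m T : ℝ} (hm : 0 < m) (hT : 0 < T) {u : ℝ} (hu : 0 ≤ u) :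
    (1 + u) ^ m ≤ (4 * T * m) ^ m * Real.exp (1 / (4 * T)) * Real.exp (u / (4 * T)) := by
  have h1 : (1 + u) / (4 * T * m) ≤ Real.exp ((1 + u) / (4 * T * m)) := by
    have := Real.add_one_le_exp ((1 + u) / (4 * T * m)); linarith
  have h2 : 1 + u ≤ 4 * T * m * Real.exp ((1 + u) / (4 * T * m)) := by
    rw [div_le_iff₀ (by positivity)] at h1; linarith
  calc (1 + u) ^ m ≤ (4 * T * m * Real.exp ((1 + u) / (4 * T * m))) ^ m := by gcongr
    _ = (4 * T * m) ^ m * Real.exp ((1 + u) / (4 * T)) := by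
      rw [Real.mul_rpow (by positivity) (Real.exp_pos _).le, ← Real.exp_mul]
      congr 2; field_simp
    _ = _ := by rw [mul_assoc (_ ^ m), ← Real.exp_add]; congr 2; ring

/-- A Peetre-type inequality, moving the polynomial weight from `y` to `x`. -/
lemma one_add_norm_sq_le {E : Type*} [NormedAddCommGroup E] (x y : E) :
    1 + ‖x‖ ^ 2 ≤ 2 * (1 + ‖y‖ ^ 2) * (1 + ‖y - x‖ ^ 2) := by
  have h : ‖x‖ ≤ ‖y‖ + ‖y - x‖ := by
    have := norm_sub_le y (y - x); simpa using this
  have h0 := norm_nonneg x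
  nlinarith [sq_nonneg (‖y‖ - ‖y - x‖), mul_nonneg (sq_nonneg ‖y‖) (sq_nonneg ‖y - x‖)]

lemma integrable_exp_neg_mul_norm_sq {b : ℝ} (hb : 0 < b) :
    Integrable fun v : EuclideanSpace ℝ (Fin d) => Real.exp (-b * ‖v‖ ^ 2) := by
  -- A non-integrable function has integral 0 by convention, while the Gaussian formula gives a
  -- positive value.
  by_contra h
  have h1 := GaussianFourier.integral_rexp_neg_mul_sq_norm (V := EuclideanSpace ℝ (Fin d)) hb
  rw [integral_undef h] at h1
  have : 0 < (Real.pi / b) ^ ((Module.finrank ℝ (EuclideanSpace ℝ (Fin d)) : ℝ) / 2) := by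
    positivity
  linarith

/-- The polynomial tail is preserved by Gaussian smoothing at bounded times. -/
lemma exists_diffused_le {γ C₂ T : ℝ} (hγ : 0 < γ) (hC₂ : 0 < C₂) (hT : 0 < T) :
    ∃ C : ℝ, 0 < C ∧ ∀ p : EuclideanSpace ℝ (Fin d) → ℝ, PolynomialTail γ C₂ p → IsDensity p →
      ∀ t, 0 < t → t ≤ T → ∀ x, diffused p t x ≤ C / (1 + ‖x‖ ^ 2) ^ ((1 + γ + d) / 2) := by
  set m : ℝ := (1 + γ + d) / 2 with hm
  have hm0 : 0 < m := by positivity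
  set A : ℝ := (4 * T * m) ^ m * Real.exp (1 / (4 * T)) with hA
  have hA0 : 0 < A := by positivity
  -- `2 ^ m` comes from Peetre, `A` from absorbing the polynomial growth, and `2 ^ (d/2)` from the
  -- variance of the remaining Gaussian being `2t` instead of `t`.
  refine ⟨C₂ * 2 ^ m * A * 2 ^ ((d : ℝ) / 2), by positivity, ?_⟩
  intro p htail hp t ht htT x
  have hc : 0 < (2 * Real.pi * t) ^ ((d : ℝ) / 2) := by positivity
  have hpt : ∀ y, gaussKernel t (x - y) * p y ≤
      C₂ * 2 ^ m * A / ((1 + ‖x‖ ^ 2) ^ m * (2 * Real.pi * t) ^ ((d : ℝ) / 2)) *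
        Real.exp (-(1 / (4 * t)) * ‖y - x‖ ^ 2) := fun y => by
    have h1 := Real.rpow_le_rpow (by positivity) (one_add_norm_sq_le x y) hm0.le
    rw [Real.mul_rpow (by positivity) (by positivity),
      Real.mul_rpow (by positivity) (by positivity)] at h1
    have h2 := one_add_rpow_le_exp hm0 hT (sq_nonneg ‖y - x‖)
    have h3 : Real.exp (‖y - x‖ ^ 2 / (4 * T)) ≤ Real.exp (‖y - x‖ ^ 2 / (4 * t)) := by
      gcongr
    have h4 : (1 + ‖x‖ ^ 2) ^ m ≤
        2 ^ m * (1 + ‖y‖ ^ 2) ^ m * (A * Real.exp (‖y - x‖ ^ 2 / (4 * t))) := by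
      refine h1.trans ?_
      gcongr
      exact h2.trans (by gcongr)
    have h5 : p y ≤ C₂ * 2 ^ m * A / (1 + ‖x‖ ^ 2) ^ m *
        Real.exp (‖y - x‖ ^ 2 / (4 * t)) := by
      refine (htail y).trans ?_
      rw [← hm, div_mul_eq_mul_div, div_le_div_iff₀ (by positivity) (by positivity)]
      calc C₂ * (1 + ‖x‖ ^ 2) ^ m ≤ C₂ * (2 ^ m * (1 + ‖y‖ ^ 2) ^ m *
            (A * Real.exp (‖y - x‖ ^ 2 / (4 * t)))) := by gcongr
        _ = _ := by ring
    have h6 : gaussWeight t x y * Real.exp (‖y - x‖ ^ 2 / (4 * t)) =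
        Real.exp (-(1 / (4 * t)) * ‖y - x‖ ^ 2) := by
      rw [gaussWeight, ← Real.exp_add]; congr 1; field_simp; ring
    rw [gaussKernel_sub, ← h6]
    have := gaussWeight_pos t x y
    calc _ ≤ 1 / (2 * Real.pi * t) ^ ((d : ℝ) / 2) * gaussWeight t x y *
          (C₂ * 2 ^ m * A / (1 + ‖x‖ ^ 2) ^ m * Real.exp (‖y - x‖ ^ 2 / (4 * t))) := by gcongr
      _ = _ := by field_simp
  have hb : 0 < 1 / (4 * t) := by positivity
  have hint := (integrable_exp_neg_mul_norm_sq (d := d) hb).comp_sub_right x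
  have hval : ∫ y : EuclideanSpace ℝ (Fin d), Real.exp (-(1 / (4 * t)) * ‖y - x‖ ^ 2) =
      2 ^ ((d : ℝ) / 2) * (2 * Real.pi * t) ^ ((d : ℝ) / 2) := by
    rw [integral_sub_right_eq_self (fun y : EuclideanSpace ℝ (Fin d) =>
      Real.exp (-(1 / (4 * t)) * ‖y‖ ^ 2)) x, GaussianFourier.integral_rexp_neg_mul_sq_norm hb,
      ← Real.mul_rpow (by positivity) (by positivity)]
    simp only [finrank_euclideanSpace, Fintype.card_fin]
    congr 1; field_simp; ring
  calc diffused p t x ≤ ∫ y, C₂ * 2 ^ m * A / ((1 + ‖x‖ ^ 2) ^ m *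
        (2 * Real.pi * t) ^ ((d : ℝ) / 2)) * Real.exp (-(1 / (4 * t)) * ‖y - x‖ ^ 2) := by
        refine integral_mono_of_nonneg (Filter.Eventually.of_forall fun y => ?_)
          (hint.const_mul _) (Filter.Eventually.of_forall hpt)
        simp only [gaussKernel_sub, Pi.zero_apply]
        have := gaussWeight_pos t x y
        have := hp.nonneg y
        positivity
    _ = _ := by
        rw [integral_const_mul, hval]; field_simp

/-- A truncated polynomial profile, bounded by its smooth rescaled version. -/
lemma mul_min_one_rpow_le {k C ρ δ r P : ℝ} (hk : 0 < k) (hC : 0 < C) (hρ : 0 < ρ) (hδ : 0 < δ)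
    (hr : 0 ≤ r) (hP : 0 ≤ P) (h : P ≤ C / (1 + r ^ 2) ^ (k / 2)) :
    ρ * min 1 (P / ρ) ^ δ ≤
      ρ * (2 ^ k * max 1 C) ^ δ * (1 + ρ ^ (1 / k) * r) ^ (-(k * δ)) := by
  set s := ρ ^ (1 / k) * r with hs
  have hs0 : 0 ≤ s := by positivity
  have hmain : min 1 (P / ρ) ≤ 2 ^ k * max 1 C * (1 + s) ^ (-k) := by
    rw [Real.rpow_neg (by positivity), ← div_eq_mul_inv, le_div_iff₀ (by positivity)]
    -- `s = 1` is the radius `ρ^{-1/k}`: inside it `min ≤ 1` and `1 + s ≤ 2`; outside it the tail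
    -- bound and `1 + s ≤ 2s` are used.
    rcases le_total s 1 with hs1 | hs1
    · calc min 1 (P / ρ) * (1 + s) ^ k ≤ 1 * 2 ^ k := by
            gcongr
            · exact min_le_left _ _
            · linarith
        _ ≤ 2 ^ k * max 1 C := by
            rw [mul_comm]; gcongr; exact le_max_left _ _
    · have hr0 : 0 < r := by
        rcases hr.lt_or_eq with h | h
        · exact h
        · rw [hs, ← h] at hs1; norm_num at hs1
      have hrk : r ^ k ≤ (1 + r ^ 2) ^ (k / 2) := by
        calc r ^ k = (r ^ 2) ^ (k / 2) := by
              rw [← Real.rpow_natCast, ← Real.rpow_mul hr]; congr 1; push_cast; ring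
          _ ≤ _ := by gcongr; linarith
      have hsk : s ^ k = ρ * r ^ k := by
        rw [hs, Real.mul_rpow (by positivity) hr, ← Real.rpow_mul hρ.le]
        simp [hk.ne']
      have h1 : P ≤ C / r ^ k := h.trans (by gcongr)
      calc min 1 (P / ρ) * (1 + s) ^ k ≤ (C / r ^ k / ρ) * (2 * s) ^ k := by
            gcongr
            · exact (min_le_right _ _).trans (by gcongr)
            · linarith
        _ = 2 ^ k * C := by
            rw [Real.mul_rpow (by norm_num) hs0, hsk]
            have : 0 < r ^ k := by positivity
            field_simp
        _ ≤ _ := by gcongr; exact le_max_right _ _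
  rw [mul_assoc]
  gcongr
  calc min 1 (P / ρ) ^ δ ≤ (2 ^ k * max 1 C * (1 + s) ^ (-k)) ^ δ := by gcongr
    _ = _ := by
      rw [Real.mul_rpow (by positivity) (by positivity), ← Real.rpow_mul (by positivity)]
      congr 2; ring

lemma lintegral_one_add_mul_norm_rpow {r R : ℝ} (hr : (d : ℝ) < r) (hR : 0 < R) :
    ∫⁻ x : EuclideanSpace ℝ (Fin d), ENNReal.ofReal ((1 + R * ‖x‖) ^ (-r)) =
      ENNReal.ofReal (R ^ (-(d : ℝ)) * ∫ x : EuclideanSpace ℝ (Fin d), (1 + ‖x‖) ^ (-r)) := by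
  have hint : Integrable fun x : EuclideanSpace ℝ (Fin d) => (1 + ‖x‖) ^ (-r) :=
    integrable_one_add_norm (by simpa using hr)
  have hcomp := hint.comp_smul hR.ne'
  have h := Measure.integral_comp_smul (volume : Measure (EuclideanSpace ℝ (Fin d)))
    (fun x => (1 + ‖x‖) ^ (-r)) R
  simp only [norm_smul, Real.norm_of_nonneg hR.le] at h hcomp
  rw [← ofReal_integral_eq_lintegral_ofReal hcomp
    (Filter.Eventually.of_forall fun x => by positivity), h]
  simp only [finrank_euclideanSpace, Fintype.card_fin, smul_eq_mul]
  rw [abs_of_pos (by positivity), Real.rpow_neg hR.le, Real.rpow_natCast]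

end

/-! ### Measurability and the expected error at a point. -/

section

variable {d n : ℕ} {Ω : Type*} [MeasurableSpace Ω] {P : Measure Ω}
  {X : Fin n → Ω → EuclideanSpace ℝ (Fin d)} {p : EuclideanSpace ℝ (Fin d) → ℝ}

lemma measurable_score (p : EuclideanSpace ℝ (Fin d) → ℝ) (t : ℝ) : Measurable (score p t) :=
  (InnerProductSpace.toDual ℝ (EuclideanSpace ℝ (Fin d))).symm.continuous.measurable.comp
    (measurable_fderiv ℝ _)

lemma measurable_uncurry_scoreEst (hn : 0 < n) {t : ℝ} (ht : 0 < t) :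
    Measurable fun z : (Fin n → EuclideanSpace ℝ (Fin d)) × EuclideanSpace ℝ (Fin d) =>
      scoreEst z.1 t z.2 := by
  simp only [scoreEst_eq hn _ ht]
  have hY : ∀ i, Continuous
      fun z : (Fin n → EuclideanSpace ℝ (Fin d)) × EuclideanSpace ℝ (Fin d) =>
        gaussWeight t z.2 (z.1 i) := fun i => by
    unfold gaussWeight; fun_prop
  have hS := continuous_finsetSum Finset.univ fun i _ => hY i
  have hW : Continuous
      fun z : (Fin n → EuclideanSpace ℝ (Fin d)) × EuclideanSpace ℝ (Fin d) =>
        ∑ i, gaussWeight t z.2 (z.1 i) • (z.1 i - z.2) :=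
    continuous_finsetSum _ fun i _ => (hY i).smul (by fun_prop)
  refine (Measurable.ite ?_ (hS.measurable.inv.smul hW.measurable)
    measurable_const).const_smul t⁻¹
  exact measurableSet_le measurable_const hS.measurable

lemma IsDensity.measurable_diffused (hp : IsDensity p) {t : ℝ} (ht : 0 < t) :
    Measurable (diffused p t) := by
  have := hp.isProbabilityMeasure
  have h : diffused p t = _ := funext (hp.diffused_eq t)
  rw [h]
  exact ((continuous_integral_gaussWeight (densityLaw p) ht).measurable).const_mul _

/-- The score error at a fixed point, in terms of the truncated density. -/
lemma lintegral_error_le [IsProbabilityMeasure P] (hp : IsDensity p) (hn : 2 ≤ n)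
    (hX : ∀ i, HasLaw (X i) (densityLaw p) P) (hind : iIndepFun X P) {t δ : ℝ} (ht : 0 < t)
    (hδ : 0 < δ) (hδ1 : δ < 1) (x : EuclideanSpace ℝ (Fin d)) :
    ∫⁻ ω, ENNReal.ofReal
      (‖scoreEst (fun i => X i ω) t x - score p t x‖ ^ 2 * diffused p t x) ∂P ≤
      ENNReal.ofReal ((384 + 16 / (1 - δ)) * Real.log n * t⁻¹ *
        (threshold d n t * min 1 (diffused p t x / threshold d n t) ^ δ)) := by
  have := hp.isProbabilityMeasure
  have hN : (2 : ℝ) ≤ n := by exact_mod_cast hn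
  have hl := half_le_log hN
  have hδ' : 0 < 1 - δ := by linarith
  set c : ℝ := 1 / (2 * Real.pi * t) ^ ((d : ℝ) / 2) with hc
  have hc0 : 0 < c := by positivity
  set q := ∫ y, gaussWeight t x y ∂(densityLaw p) with hq
  have hq0 : 0 < q := integral_gaussWeight_pos _ ht x
  set m := ∫ y, gaussWeight t x y • (y - x) ∂(densityLaw p) with hm
  have hmq : ‖m‖ ^ 2 ≤ 2 * t * q ^ 2 * -Real.log q :=
    norm_sq_integral_exp_smul_le (ν := densityLaw p) (u := fun y => y - x)
      (by fun_prop) ht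
  have hWS : ∀ ω, ‖∑ i, gaussWeight t x (X i ω) • (X i ω - x)‖ ^ 2 ≤
      2 * t * (∑ i, gaussWeight t x (X i ω)) ^ 2 *
        Real.log (n / ∑ i, gaussWeight t x (X i ω)) := fun ω =>
    norm_sq_sum_exp_smul_le (by omega) (fun i => X i ω - x) ht
  have hthr : threshold d n t = c * (Real.log n / n) := by
    rw [threshold, hc]; field_simp
  have hratio : diffused p t x / threshold d n t = q / (Real.log n / n) := by
    rw [hthr, hp.diffused_eq, mul_div_mul_left _ _ hc0.ne']
  rw [hratio, hthr]
  have hint : ∀ ω, ‖scoreEst (fun i => X i ω) t x - score p t x‖ ^ 2 * diffused p t x =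
      c * t⁻¹ ^ 2 * (q * ‖(if Real.log n ≤ ∑ i, gaussWeight t x (X i ω) then
        (∑ i, gaussWeight t x (X i ω))⁻¹ • ∑ i, gaussWeight t x (X i ω) • (X i ω - x) else 0)
          - q⁻¹ • m‖ ^ 2) := fun ω => by
    rw [scoreEst_eq (by omega) _ ht, hp.score_eq ht, hp.diffused_eq, ← smul_sub, norm_smul,
      Real.norm_of_nonneg (by positivity)]
    ring
  simp only [hint]
  rcases le_total q (2 * (Real.log n / n)) with hs | hs
  · calc _ ≤ ∫⁻ _ω, ENNReal.ofReal (c * t⁻¹ ^ 2 * ((32 + 16 / (1 - δ)) * t * Real.log n *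
          (Real.log n / n * min 1 (q / (Real.log n / n)) ^ δ))) ∂P := by
          refine lintegral_mono fun ω => ENNReal.ofReal_le_ofReal ?_
          exact mul_le_mul_of_nonneg_left
            (error_le_of_small ht hN (hWS ω) hq0 hmq hδ hδ1 hs) (by positivity)
      _ = ENNReal.ofReal ((32 + 16 / (1 - δ)) * Real.log n * t⁻¹ * (c * (Real.log n / n) *
          min 1 (q / (Real.log n / n)) ^ δ)) := by
          rw [lintegral_const, measure_univ, mul_one]
          congr 1; field_simp
      _ ≤ _ := by
          apply ENNReal.ofReal_le_ofReal
          gcongr; norm_num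
  · have hmin : min 1 (q / (Real.log n / n)) ^ δ = 1 := by
      rw [min_eq_left, Real.one_rpow]
      rw [le_div_iff₀ (by positivity)]
      have : 0 < Real.log n / n := by positivity
      linarith
    rw [hmin, mul_one]
    set V : Ω → ℝ := fun ω => ‖∑ i, gaussWeight t x (X i ω) • (X i ω - x) - (n : ℝ) • m‖ ^ 2 +
        t * (∑ i, gaussWeight t x (X i ω) - n * q) ^ 2 with hV
    have hD : 0 ≤ c * t⁻¹ ^ 2 * (64 * Real.log n / ((n : ℝ) ^ 2 * q)) := by positivity
    calc _ ≤ ∫⁻ ω, ENNReal.ofReal (c * t⁻¹ ^ 2 * (64 * Real.log n / ((n : ℝ) ^ 2 * q))) *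
          ENNReal.ofReal (V ω) ∂P := by
          refine lintegral_mono fun ω => ?_
          rw [← ENNReal.ofReal_mul hD]
          refine ENNReal.ofReal_le_ofReal ?_
          rw [mul_assoc (c * t⁻¹ ^ 2) _ (V ω)]
          exact mul_le_mul_of_nonneg_left
            (error_le_of_large ht hN (hWS ω) hmq hs) (by positivity)
      _ = ENNReal.ofReal (c * t⁻¹ ^ 2 * (64 * Real.log n / ((n : ℝ) ^ 2 * q))) *
          ∫⁻ ω, ENNReal.ofReal (V ω) ∂P := lintegral_const_mul' _ _ ENNReal.ofReal_ne_top
      _ ≤ ENNReal.ofReal (c * t⁻¹ ^ 2 * (64 * Real.log n / ((n : ℝ) ^ 2 * q))) *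
          ENNReal.ofReal (3 * t * n * q) := by
          gcongr
          exact lintegral_deviation_le hX hind ht x
      _ ≤ _ := by
          rw [← ENNReal.ofReal_mul hD]
          apply ENNReal.ofReal_le_ofReal
          have h0 : 0 ≤ 16 / (1 - δ) := by positivity
          -- `384 / 2 = 64 · 3`; the half is then replaced by `log n ≥ 1/2`.
          calc _ = 384 * (1 / 2) * (t⁻¹ * c * Real.log n / n) := by field_simp; norm_num
            _ ≤ (384 + 16 / (1 - δ)) * Real.log n * (t⁻¹ * c * Real.log n / n) := by
              gcongr; linarith
            _ = _ := by ring

end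

end ScoreKDE

/-! ### Choice of exponents and integration over space. -/

theorem theorem1 (d : ℕ) (hd : 1 ≤ d) (γ C₂ T : ℝ) (hγ : 0 < γ) (hC₂ : 0 < C₂) (hT : 0 < T) :
    ∃ K κ : ℝ, 0 < K ∧ 0 < κ ∧
      ∀ (β L : ℝ), 0 < β → 0 < L →
      ∀ (p₀ : EuclideanSpace ℝ (Fin d) → ℝ),
        ScoreKDE.PolynomialTail γ C₂ p₀ → ScoreKDE.SobolevClass β L p₀ →
      ∀ (n : ℕ), 2 ≤ n → ∀ (t : ℝ), 0 < t → t ≤ T →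
      ∀ (Ω : Type*) [MeasurableSpace Ω] (P : Measure Ω) [IsProbabilityMeasure P]
        (X : Fin n → Ω → EuclideanSpace ℝ (Fin d)),
        (∀ i, HasLaw (X i) (ScoreKDE.densityLaw p₀) P) → iIndepFun X P →
        ∫⁻ ω, (∫⁻ x, ENNReal.ofReal
            (‖ScoreKDE.scoreEst (fun i => X i ω) t x - ScoreKDE.score p₀ t x‖ ^ 2
              * ScoreKDE.diffused p₀ t x)) ∂P
          ≤ ENNReal.ofReal (K * Real.log n ^ κ
              * (n : ℝ) ^ (-((γ + 1) / (d + γ + 1)))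
              * t ^ (-1 - (d : ℝ) / 2 * ((γ + 1) / (d + γ + 1)))) := by
  obtain ⟨C, hC, hdiff⟩ := ScoreKDE.exists_diffused_le (d := d) hγ hC₂ hT
  set k : ℝ := 1 + γ + d with hk
  have hk0 : 0 < k := by positivity
  -- The midpoint of `d/k` and `1`: above `d/k` for integrability, below `1` for the logarithm.
  set δ : ℝ := (d + (γ + 1) / 2) / k with hδdef
  have hδ : 0 < δ := by positivity
  have hδ1 : δ < 1 := by rw [hδdef, div_lt_one hk0]; linarith
  have hδ' : 0 < 1 - δ := by linarith
  have hkδ : (d : ℝ) < k * δ := by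
    have : k * δ = d + (γ + 1) / 2 := by rw [hδdef]; field_simp
    linarith
  set a : ℝ := (γ + 1) / (d + γ + 1) with ha
  have ha0 : 0 < a := by positivity
  set I : ℝ := ∫ x : EuclideanSpace ℝ (Fin d), (1 + ‖x‖) ^ (-(k * δ)) with hI
  have hI0 : 0 ≤ I := integral_nonneg fun x => by positivity
  set K₀ : ℝ := (384 + 16 / (1 - δ)) * (2 ^ k * max 1 C) ^ δ with hK₀
  have hK₀0 : 0 < K₀ := by positivity
  -- `κ = 1 + a`: one logarithm from the pointwise bound, `a` from `ρ ^ a`, which also yields the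
  -- power of `2π`. `I + 1` makes positivity of `K` immediate from `0 ≤ I`.
  refine ⟨K₀ * (I + 1) * (2 * Real.pi) ^ (-((d : ℝ) / 2 * a)), 1 + a, by positivity, by positivity,
    ?_⟩
  intro β L _ _ p htail hsob n hn t ht htT Ω _ P _ X hX hind
  have hp := hsob.toIsDensity
  have hN : (2 : ℝ) ≤ n := by exact_mod_cast hn
  have hl : 0 < Real.log n := by linarith [ScoreKDE.half_le_log hN]
  set ρ := ScoreKDE.threshold d n t with hρ
  have hρ0 : 0 < ρ := by rw [hρ, ScoreKDE.threshold]; positivity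
  have hmeas : AEMeasurable (Function.uncurry fun ω x => ENNReal.ofReal
      (‖ScoreKDE.scoreEst (fun i => X i ω) t x - ScoreKDE.score p t x‖ ^ 2
        * ScoreKDE.diffused p t x)) (P.prod volume) := by
    have hmap : AEMeasurable (fun z : Ω × EuclideanSpace ℝ (Fin d) =>
        ((fun i => X i z.1), z.2)) (P.prod volume) :=
      (aemeasurable_pi_iff.2 fun i => (hX i).aemeasurable.comp_fst).prodMk measurable_snd.aemeasurable
    have h1 := (ScoreKDE.measurable_uncurry_scoreEst (d := d) (n := n) (by omega)
      ht).comp_aemeasurable hmap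
    have h2 := ((ScoreKDE.measurable_score p t).comp
      (measurable_snd (α := Ω))).aemeasurable (μ := P.prod volume)
    have h3 := ((hp.measurable_diffused ht).comp
      (measurable_snd (α := Ω))).aemeasurable (μ := P.prod volume)
    exact (((h1.sub h2).norm.pow_const 2).mul h3).ennreal_ofReal
  rw [lintegral_lintegral_swap hmeas]
  have hpoint : ∀ x : EuclideanSpace ℝ (Fin d), ∫⁻ ω, ENNReal.ofReal
      (‖ScoreKDE.scoreEst (fun i => X i ω) t x - ScoreKDE.score p t x‖ ^ 2
        * ScoreKDE.diffused p t x) ∂P ≤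
      ENNReal.ofReal (K₀ * Real.log n * t⁻¹ * ρ) *
        ENNReal.ofReal ((1 + ρ ^ (1 / k) * ‖x‖) ^ (-(k * δ))) := fun x => by
    refine (ScoreKDE.lintegral_error_le hp hn hX hind ht hδ hδ1 x).trans ?_
    rw [← ENNReal.ofReal_mul (by positivity)]
    apply ENNReal.ofReal_le_ofReal
    have hpos : 0 ≤ ScoreKDE.diffused p t x := by
      have := hp.isProbabilityMeasure
      rw [hp.diffused_eq]
      have := ScoreKDE.integral_gaussWeight_pos (ScoreKDE.densityLaw p) ht x
      positivity
    calc _ ≤ (384 + 16 / (1 - δ)) * Real.log n * t⁻¹ *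
          (ρ * (2 ^ k * max 1 C) ^ δ * (1 + ρ ^ (1 / k) * ‖x‖) ^ (-(k * δ))) := by
          refine mul_le_mul_of_nonneg_left ?_ (by positivity)
          exact ScoreKDE.mul_min_one_rpow_le hk0 hC hρ0 hδ (norm_nonneg x) hpos
            (hdiff p htail hp t ht htT x)
      _ = _ := by rw [hK₀]; ring
  refine (lintegral_mono hpoint).trans ?_
  rw [lintegral_const_mul' _ _ ENNReal.ofReal_ne_top,
    ScoreKDE.lintegral_one_add_mul_norm_rpow hkδ (by positivity),
    ← ENNReal.ofReal_mul (by positivity)]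
  apply ENNReal.ofReal_le_ofReal
  -- The exponents combine as `1 - d/k = (γ+1)/k = a`.
  have hρa : ρ * (ρ ^ (1 / k)) ^ (-(d : ℝ)) = ρ ^ a := by
    rw [← Real.rpow_mul hρ0.le]
    nth_rewrite 1 [← Real.rpow_one ρ]
    rw [← Real.rpow_add hρ0]
    congr 1
    have : (d : ℝ) + γ + 1 = k := by rw [hk]; ring
    rw [ha, this]; field_simp; rw [hk]; ring
  have hρval : ρ ^ a = Real.log n ^ a * (n : ℝ) ^ (-a) *
      ((2 * Real.pi) ^ (-((d : ℝ) / 2 * a)) * t ^ (-((d : ℝ) / 2 * a))) := by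
    rw [← Real.mul_rpow (by positivity) ht.le, hρ, ScoreKDE.threshold,
      Real.div_rpow hl.le (by positivity), Real.mul_rpow (by positivity) (by positivity),
      ← Real.rpow_mul (by positivity), Real.rpow_neg (by positivity), Real.rpow_neg (by positivity)]
    field_simp
  have ht' : t ^ (-1 - (d : ℝ) / 2 * a) = t⁻¹ * t ^ (-((d : ℝ) / 2 * a)) := by
    rw [sub_eq_add_neg, Real.rpow_add ht, Real.rpow_neg_one]
  have hl' : Real.log n ^ (1 + a) = Real.log n * Real.log n ^ a := by
    rw [Real.rpow_add hl, Real.rpow_one]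
  calc K₀ * Real.log n * t⁻¹ * ρ * ((ρ ^ (1 / k)) ^ (-(d : ℝ)) * I)
      = K₀ * Real.log n * t⁻¹ * (ρ * (ρ ^ (1 / k)) ^ (-(d : ℝ))) * I := by ring
    _ ≤ K₀ * Real.log n * t⁻¹ * ρ ^ a * (I + 1) := by rw [hρa]; gcongr; linarith
    _ = _ := by rw [hρval, ht', hl']; ring
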